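/- Let $r\ge 2$, let $a_1\ge\cdots\ge a_r>0$ be real numbers and put $A:=a_1+\cdots+a_r$. Let $$\zeta(s_1,\dots,s_r)=\sum_{1\le n_1<\cdots<n_r}\frac{1}{n_1^{s_1}\cdots n_r^{s_r}}$$ be the Euler–Zagier multiple zeta function, and let $$\widetilde\zeta(s):=\sum_{\tau\in\mathfrak S_r}\zeta(a_{\tau(1)}s,\dots,a_{\tau(r)}s),$$ a meromorphic function of $s=\sigma+it$ on $\mathbb C$ (the series converge absolutely when $\sigma$ is large, and $\widetilde\zeta$ is the meromorphic continuation of their sum). For $a\in\mathbb C$, an $a$-point of $\widetilde\zeta$ is a (regular) point $s$ with $\widetilde\zeta(s)=a$. There is an $\epsilon_0>0$, depending only on $a_1,\dots,a_r$, such that for all $a\in\mathbb C$, $p>0$ and $0<\epsilon<\epsilon_0$ there is a constant $C_2<0$ with the following two properties, where $$D(C_2,p):=\{s\in\mathbb C : \sigma\le\min\{C_2,-pt^2\}\}.$$ 1. $\widetilde\zeta$ has no $a$-point in $D(C_2,p)\setminus\bigcup_{n=1}^{\infty}\{s\in\mathbb C: |s+2n/A|\le\epsilon\}$. 2. For every integer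 $n\ge1$ such that the disc $\{s\in\mathbb C: |s+2n/A|\le\epsilon\}$ meets $D(C_2,p)$, this disc contains exactly one $a$-point of $\widetilde\zeta$. -/

import Mathlib

/-- The Euler-Zagier series `∑_{1 ≤ n₁ < ⋯ < n_r} 1 / (n₁ ^ z₁ ⋯ n_r ^ z_r)`. -/
noncomputable def multiZetaSeries {r : ℕ} (z : Fin r → ℂ) : ℂ :=
  ∑' n : {n : Fin r → ℕ // (∀ j, 1 ≤ n j) ∧ StrictMono n},
    1 / ∏ j, ((n.1 j : ℂ) ^ z j)

/-- The symmetric sum `∑_τ ζ(a_{τ(1)} s, …, a_{τ(r)} s)` of Euler-Zagier series, which converges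
absolutely when the real part of `s` is large. -/
noncomputable def symmMultiZetaSeries {r : ℕ} (a : Fin r → ℝ) (s : ℂ) : ℂ :=
  ∑ τ : Equiv.Perm (Fin r), multiZetaSeries fun j => (a (τ j) : ℂ) * s

/-- `F` is a meromorphic continuation to the whole plane of a function `f` given for large real
part. The normal form fixes the values of `F`: they are the continuous ones off the poles. -/
def IsMeromorphicContinuation (f F : ℂ → ℂ) : Prop :=
  MeromorphicNFOn F Set.univ ∧ ∃ c : ℝ, ∀ s : ℂ, c < s.re → F s = f s

/-- The meromorphic continuation is unique. -/
theorem IsMeromorphicContinuation.unique {f F G : ℂ → ℂ}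
    (hF : IsMeromorphicContinuation f F) (hG : IsMeromorphicContinuation f G) : F = G := by
  obtain ⟨hF, c, hc⟩ := hF
  obtain ⟨hG, d, hd⟩ := hG
  have hm : MeromorphicOn (F - G) Set.univ := hF.meromorphicOn.sub hG.meromorphicOn
  have hx : meromorphicOrderAt (F - G) ((max c d + 1 : ℝ) : ℂ) = ⊤ := by
    rw [meromorphicOrderAt_eq_top_iff]
    apply Filter.Eventually.filter_mono nhdsWithin_le_nhds
    have ho : IsOpen {s : ℂ | max c d < s.re} := isOpen_lt continuous_const Complex.continuous_re
    filter_upwards [ho.mem_nhds (show max c d < (((max c d + 1 : ℝ) : ℂ)).re by simp)] with s hs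
    have hs' : max c d < s.re := hs
    simp [hc s ((le_max_left _ _).trans_lt hs'), hd s ((le_max_right _ _).trans_lt hs')]
  funext z
  have hz : meromorphicOrderAt (F - G) z = ⊤ := by
    by_contra h
    exact hm.meromorphicOrderAt_ne_top_of_isPreconnected isPreconnected_univ
      (Set.mem_univ z) (Set.mem_univ _) h hx
  rw [meromorphicOrderAt_eq_top_iff] at hz
  have hz' : F =ᶠ[nhdsWithin z {z}ᶜ] G := by
    filter_upwards [hz] with s hs
    simpa [sub_eq_zero] using hs
  exact (((hF (Set.mem_univ z)).eventuallyEq_nhdsNE_iff_eventuallyEq_nhds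
    (hG (Set.mem_univ z))).1 hz').eq_of_nhds

open Classical in
/-- The meromorphic continuation of `f` to the whole plane (zero if there is none). -/
noncomputable def meromorphicContinuation (f : ℂ → ℂ) : ℂ → ℂ :=
  if h : ∃ F, IsMeromorphicContinuation f F then h.choose else 0

/-- The function `ζ̃`: the symmetric sum of the multiple zeta functions
`ζ(a_{τ(1)} s, …, a_{τ(r)} s)`, as a meromorphic function of `s` on the whole plane. -/
noncomputable def symmMultiZeta {r : ℕ} (a : Fin r → ℝ) : ℂ → ℂ :=
  meromorphicContinuation (symmMultiZetaSeries a)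

/-- `s` is an `α`-point of `F`: a regular point at which `F` takes the value `α`. -/
def IsValuePoint (F : ℂ → ℂ) (α s : ℂ) : Prop :=
  AnalyticAt ℂ F s ∧ F s = α

/-- The closed disc of radius `ε` about `-2n/A`, where `A` is the sum of the weights. -/
def trivialDisc {r : ℕ} (a : Fin r → ℝ) (ε : ℝ) (n : ℕ) : Set ℂ :=
  {s : ℂ | ‖s + 2 * (n : ℂ) / ((∑ j, a j : ℝ) : ℂ)‖ ≤ ε}

/-- The parabolic region `σ ≤ min {C, -p t²}`. -/
def parabolicRegion (C p : ℝ) : Set ℂ :=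
  {s : ℂ | s.re ≤ min C (-p * s.im ^ 2)}

/-! Sorting indices turns the symmetric sum into a sum of `∏ n_i ^ (-a_i s)` over injective tuples.
Inclusion-exclusion, one variable at a time (`injSum_cons`), gives `ζ̃(s) = c ζ(A s) + g(s)` with `c
= (-1)^(r-1) (r-1)!` and `g` a combination of products of at least two `ζ(b s)` whose weights `b`
add up to `A`.

On the left, `ζ(b s) = sin(π b s / 2) * dualZeta (1 - b s)`. Since `Γ(u) Γ(v) = B(u, v) Γ(u + v)`
and the beta integral decays exponentially, two dual factors of weights `b` and `W` are
exponentially smaller in `|σ|` than the single one of weight `b + W` (`norm_dualZeta_mul_le`). The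
sines in `g` cost only `exp(O(|t|))`, which is harmless where `t ^ 2 ≤ |σ| / p`. So `g`, and also
the constant `α`, are negligible against `D(s) = dualZeta (1 - A s)`.

Dividing by `c D`, the `α`-points become the solutions of `sin(π A s / 2) + q(s) = 0` with `q → 0`
in the parabola. Away from the zeros `-2n/A` the sine dominates; near each of them a contraction
argument (`existsUnique_sin_add_eq_zero`) gives exactly one solution. -/

open Filter Topology Asymptotics

/-! ### Sums over injective tuples -/

open Classical in
/-- The sum of `∏ i, f i (n i)` over the injective tuples `n`. -/
noncomputable def injSum {k : ℕ} (f : Fin k → ℕ → ℂ) : ℂ :=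
  ∑' n : Fin k → ℕ, if Function.Injective n then ∏ i, f i (n i) else 0

theorem summable_norm_prod_apply {k : ℕ} (f : Fin k → ℕ → ℂ)
    (hf : ∀ i, Summable fun n => ‖f i n‖) :
    Summable fun n : Fin k → ℕ => ‖∏ i, f i (n i)‖ := by
  induction k with
  | zero => exact Summable.of_finite
  | succ k ih =>
    have h := (hf 0).mul_norm (ih (fun i => f i.succ) fun i => hf i.succ)
    rw [← (Fin.consEquiv fun _ => ℕ).summable_iff]
    refine h.congr fun x => ?_
    simp [Fin.consEquiv, Fin.prod_univ_succ]

open Classical in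
theorem summable_norm_injective_prod {k : ℕ} (f : Fin k → ℕ → ℂ)
    (hf : ∀ i, Summable fun n => ‖f i n‖) :
    Summable fun n : Fin k → ℕ => ‖if Function.Injective n then ∏ i, f i (n i) else 0‖ := by
  refine (summable_norm_prod_apply f hf).of_nonneg_of_le (fun _ => norm_nonneg _) fun n => ?_
  split_ifs
  · exact le_rfl
  · simpa only [norm_zero] using norm_nonneg _

theorem injSum_one (f : Fin 1 → ℕ → ℂ) : injSum f = ∑' n, f 0 n := by
  rw [injSum, ← (Equiv.funUnique (Fin 1) ℕ).symm.tsum_eq]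
  refine tsum_congr fun n => ?_
  rw [if_pos (Function.injective_of_subsingleton _)]
  simp

/-- Expand the product on the right: the new index either avoids all `n i`, which gives the left
side, or equals exactly one of them by injectivity, which fuses `f₀` with `f i`. -/
theorem injSum_cons {k : ℕ} (f₀ : ℕ → ℂ) (f : Fin k → ℕ → ℂ)
    (hf₀ : Summable fun n => ‖f₀ n‖) (hf : ∀ i, Summable fun n => ‖f i n‖) :
    injSum (Fin.cons f₀ f : Fin (k + 1) → ℕ → ℂ) =
      (∑' n, f₀ n) * injSum f - ∑ i, injSum (Function.update f i (f i * f₀)) := by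
  classical
  set G : (Fin k → ℕ) → ℂ := fun n => if Function.Injective n then ∏ i, f i (n i) else 0 with hG
  have hGs : Summable fun n => ‖G n‖ := summable_norm_injective_prod f hf
  have hpt : ∀ x : ℕ × (Fin k → ℕ), f₀ x.1 * G x.2 =
      (if Function.Injective (Fin.cons x.1 x.2 : Fin (k + 1) → ℕ) then
        f₀ x.1 * ∏ i, f i (x.2 i) else 0) +
      ∑ i, if x.1 = x.2 i then f₀ x.1 * G x.2 else 0 := by
    rintro ⟨m, n⟩
    by_cases hn : Function.Injective n
    · by_cases hm : ∃ i, m = n i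
      · obtain ⟨i, rfl⟩ := hm
        have h1 : ¬ Function.Injective (Fin.cons (n i) n : Fin (k + 1) → ℕ) := by
          rw [Fin.cons_injective_iff]; simp
        simp [h1, hn.eq_iff]
      · have h1 : Function.Injective (Fin.cons m n : Fin (k + 1) → ℕ) := by
          rw [Fin.cons_injective_iff]
          exact ⟨fun ⟨i, hi⟩ => hm ⟨i, hi.symm⟩, hn⟩
        push Not at hm
        simp [h1, hn, hG, hm]
    · have h1 : ¬ Function.Injective (Fin.cons m n : Fin (k + 1) → ℕ) := by
        rw [Fin.cons_injective_iff]; tauto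
      simp [h1, hn, hG]
  have hFs : Summable fun x : ℕ × (Fin k → ℕ) => ‖f₀ x.1 * ∏ i, f i (x.2 i)‖ :=
    Summable.mul_norm (f := f₀) (g := fun n : Fin k → ℕ => ∏ i, f i (n i)) hf₀
      (summable_norm_prod_apply f hf)
  have hFG : Summable fun x : ℕ × (Fin k → ℕ) => ‖f₀ x.1 * G x.2‖ :=
    Summable.mul_norm (f := f₀) (g := G) hf₀ hGs
  have hsi : ∀ i, Summable fun x : ℕ × (Fin k → ℕ) =>
      if x.1 = x.2 i then f₀ x.1 * G x.2 else 0 := by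
    intro i
    refine Summable.of_norm_bounded hFG fun x => ?_
    split_ifs
    · exact le_rfl
    · simpa only [norm_zero] using norm_nonneg _
  have hs0 : Summable fun x : ℕ × (Fin k → ℕ) =>
      (if Function.Injective (Fin.cons x.1 x.2 : Fin (k + 1) → ℕ) then
        f₀ x.1 * ∏ i, f i (x.2 i) else 0) := by
    refine Summable.of_norm_bounded hFs fun x => ?_
    split_ifs
    · exact le_rfl
    · simpa only [norm_zero] using norm_nonneg _
  have e0 : ∑' x : ℕ × (Fin k → ℕ),
      (if Function.Injective (Fin.cons x.1 x.2 : Fin (k + 1) → ℕ) then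
        f₀ x.1 * ∏ i, f i (x.2 i) else 0) = injSum (Fin.cons f₀ f : Fin (k + 1) → ℕ → ℂ) := by
    rw [injSum, ← (Fin.consEquiv fun _ => ℕ).tsum_eq]
    refine tsum_congr fun x => ?_
    simp [Fin.consEquiv, Fin.prod_univ_succ]
  have ei : ∀ i, ∑' x : ℕ × (Fin k → ℕ), (if x.1 = x.2 i then f₀ x.1 * G x.2 else 0) =
      injSum (Function.update f i (f i * f₀)) := by
    intro i
    have hinj : Function.Injective fun n : Fin k → ℕ => (n i, n) := fun x y h => by
      simpa using (congrArg Prod.snd h)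
    rw [injSum, ← hinj.tsum_eq]
    · refine tsum_congr fun n => ?_
      simp only [if_true, hG]
      split_ifs
      · rw [← Finset.mul_prod_erase _ _ (Finset.mem_univ i),
          ← Finset.mul_prod_erase _ (fun j => Function.update f i (f i * f₀) j (n j))
            (Finset.mem_univ i)]
        have : ∏ j ∈ Finset.univ.erase i, Function.update f i (f i * f₀) j (n j) =
            ∏ j ∈ Finset.univ.erase i, f j (n j) :=
          Finset.prod_congr rfl fun j hj => by
            rw [Function.update_of_ne (Finset.ne_of_mem_erase hj)]
        rw [this]
        simp
        ring
      · simp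
    · intro x hx
      simp only [Function.mem_support, ne_eq, ite_eq_right_iff, Classical.not_imp] at hx
      exact ⟨x.2, Prod.ext hx.1.symm rfl⟩
  have hG' : injSum f = ∑' n, G n := rfl
  rw [hG', tsum_mul_tsum_of_summable_norm hf₀ hGs, tsum_congr hpt,
    hs0.tsum_add (summable_sum fun i _ => hsi i), Summable.tsum_finsetSum fun i _ => hsi i, e0]
  simp [ei]

/-- Ordering the values of an injective tuple. -/
theorem bijective_perm_comp (k : ℕ) :
    Function.Bijective fun x : Equiv.Perm (Fin k) × {n : Fin k → ℕ // StrictMono n} =>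
      (⟨x.2.1 ∘ x.1.symm, x.2.2.injective.comp x.1.symm.injective⟩ :
        {n : Fin k → ℕ // Function.Injective n}) := by
  constructor
  · rintro ⟨σ, n, hn⟩ ⟨τ, m, hm⟩ h
    have h' : n ∘ σ.symm = m ∘ τ.symm := congrArg Subtype.val h
    have hr : n = m := by
      rw [← hn.range_inj hm, ← σ.symm.surjective.range_comp n, h',
        τ.symm.surjective.range_comp m]
    subst hr
    have : σ.symm = τ.symm := Equiv.ext fun i => hn.injective (congrFun h' i)
    have : σ = τ := by rw [← σ.symm_symm, this, τ.symm_symm]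
    subst this
    rfl
  · rintro ⟨m, hm⟩
    refine ⟨⟨Tuple.sort m, m ∘ Tuple.sort m, (Tuple.monotone_sort m).strictMono_of_injective
      (hm.comp (Tuple.sort m).injective)⟩, ?_⟩
    ext i
    simp

theorem sum_perm_tsum_strictMono {k : ℕ} (f : Fin k → ℕ → ℂ)
    (hf : ∀ i, Summable fun n => ‖f i n‖) :
    ∑ τ : Equiv.Perm (Fin k), ∑' n : {n : Fin k → ℕ // StrictMono n},
      ∏ j, f (τ j) (n.1 j) = injSum f := by
  classical
  have h1 : injSum f = ∑' n : {n : Fin k → ℕ // Function.Injective n}, ∏ i, f i (n.1 i) := by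
    rw [injSum]
    refine Eq.trans ?_ (tsum_subtype {n : Fin k → ℕ | Function.Injective n}
      fun n => ∏ i, f i (n i)).symm
    refine tsum_congr fun n => ?_
    simp [Set.indicator_apply]
  set e := Equiv.ofBijective _ (bijective_perm_comp k) with he
  have hpr : ∀ x : Equiv.Perm (Fin k) × {n : Fin k → ℕ // StrictMono n},
      ∏ i, f i ((e x).1 i) = ∏ j, f (x.1 j) (x.2.1 j) := by
    intro x
    rw [← Equiv.prod_comp x.1]
    simp [he]
  have hs : Summable fun n : {n : Fin k → ℕ // Function.Injective n} => ∏ i, f i (n.1 i) :=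
    ((summable_norm_prod_apply f hf).of_norm).subtype _
  have hs' : Summable fun x : Equiv.Perm (Fin k) × {n : Fin k → ℕ // StrictMono n} =>
      ∏ j, f (x.1 j) (x.2.1 j) := (e.summable_iff.2 hs).congr hpr
  rw [h1, ← e.tsum_eq, tsum_congr hpr]
  rw [hs'.tsum_prod, tsum_fintype]

/-! ### Symmetric sums in terms of products of zeta functions -/

/-- The span of the products `∏ ζ(b s)` of at least two factors with positive weights `b` of
sum `W`. -/
def zetaProducts (W : ℝ) : Submodule ℂ (ℂ → ℂ) :=
  Submodule.span ℂ {g | ∃ L : List ℝ, (∀ b ∈ L, 0 < b) ∧ L.sum = W ∧ 2 ≤ L.length ∧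
    g = fun s => (L.map fun b : ℝ => riemannZeta (b * s)).prod}

theorem riemannZeta_mul_mem_zetaProducts {W b : ℝ} (hb : 0 < b) {g : ℂ → ℂ}
    (hg : g ∈ zetaProducts W) : (fun s => riemannZeta (b * s) * g s) ∈ zetaProducts (b + W) := by
  induction hg using Submodule.span_induction with
  | mem g hg =>
    obtain ⟨L, hL, hs, hl, rfl⟩ := hg
    exact Submodule.subset_span ⟨b :: L, by simpa [hb] using hL, by simp [hs], by simp; omega,
      by simp⟩
  | zero =>
    simp only [Pi.zero_apply, mul_zero]
    exact Submodule.zero_mem _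
  | add f g _ _ hf hg => simpa [mul_add] using! Submodule.add_mem _ hf hg
  | smul c g _ hg => simpa [mul_left_comm] using! Submodule.smul_mem _ c hg

theorem riemannZeta_mul_riemannZeta_mem_zetaProducts {W b : ℝ} (hb : 0 < b) (hW : 0 < W) :
    (fun s : ℂ => riemannZeta (b * s) * riemannZeta (W * s)) ∈ zetaProducts (b + W) :=
  Submodule.subset_span ⟨[b, W], by simp [hb, hW], by simp, by simp, by simp⟩

theorem summable_norm_one_div_cpow {b : ℝ} {s : ℂ} (h : 1 < b * s.re) :
    Summable fun n : ℕ => ‖1 / (n : ℂ) ^ ((b : ℂ) * s)‖ :=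
  (Complex.summable_one_div_nat_cpow.2 (by simpa using h)).norm

theorem one_div_cpow_mul_one_div_cpow {x y : ℂ} (hx : 0 < x.re) (hy : 0 < y.re) (n : ℕ) :
    1 / (n : ℂ) ^ x * (1 / (n : ℂ) ^ y) = 1 / (n : ℂ) ^ (x + y) := by
  -- At `n = 0` both sides are `0`, because `0 ^ x = 0` for `x ≠ 0` and `1 / 0 = 0`; the positive
  -- real parts keep the exponents nonzero.
  rcases eq_or_ne n 0 with rfl | hn
  · have h1 : x ≠ 0 := fun h => by simp [h] at hx
    have h2 : x + y ≠ 0 := fun h => by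
      have := congrArg Complex.re h
      simp at this; linarith
    simp [Complex.zero_cpow h1, Complex.zero_cpow h2]
  · rw [Complex.cpow_add _ _ (Nat.cast_ne_zero.2 hn)]
    field_simp

/-- Each of the `k + 1` fused tuples in `injSum_cons` contributes `(-1)^k k! ζ` of the total weight;
subtracting them yields `(-1)^(k+1) (k+1)!`. Every other term has at least two zeta factors. -/
theorem injSum_eq_riemannZeta_add (k : ℕ) (b : Fin (k + 1) → ℝ) (hb : ∀ i, 0 < b i) :
    ∃ g ∈ zetaProducts (∑ i, b i), ∀ s : ℂ, (∀ i, 1 < b i * s.re) →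
      injSum (fun i (n : ℕ) => 1 / (n : ℂ) ^ ((b i : ℂ) * s)) =
        (-1) ^ k * (k.factorial : ℂ) * riemannZeta (((∑ i, b i : ℝ) : ℂ) * s) + g s := by
  induction k with
  | zero =>
    refine ⟨0, Submodule.zero_mem _, fun s hs => ?_⟩
    rw [injSum_one]
    have h0 := hs 0
    simp only [Pi.zero_apply]
    rw [zeta_eq_tsum_one_div_nat_cpow (by simpa using h0)]
    simp
  | succ k ih =>
    set b₀ := b 0 with hb₀
    set b' : Fin (k + 1) → ℝ := fun i => b i.succ with hb'
    have h₀ : 0 < b₀ := hb 0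
    have h' : ∀ i, 0 < b' i := fun i => hb i.succ
    have hsum : ∑ i, b i = b₀ + ∑ i, b' i := Fin.sum_univ_succ b
    have hup : ∀ i j, 0 < Function.update b' i (b' i + b₀) j := fun i j => by
      rcases eq_or_ne j i with rfl | h
      · simpa using add_pos (h' j) h₀
      · simpa [h] using h' j
    have hupsum : ∀ i, ∑ j, Function.update b' i (b' i + b₀) j = b₀ + ∑ j, b' j := fun i => by
      rw [Finset.sum_update_of_mem (Finset.mem_univ i),
        ← Finset.add_sum_erase _ b' (Finset.mem_univ i), Finset.sdiff_singleton_eq_erase]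
      ring
    obtain ⟨g, hg, hgs⟩ := ih b' h'
    choose G hG hGs using fun i => ih (Function.update b' i (b' i + b₀)) (hup i)
    have hpos : 0 < ∑ i, b' i := Finset.sum_pos (fun i _ => h' i) Finset.univ_nonempty
    rw [hsum]
    refine ⟨(((-1) ^ k * (k.factorial : ℂ)) • fun s : ℂ => riemannZeta (b₀ * s) *
        riemannZeta (((∑ i, b' i : ℝ) : ℂ) * s)) + (fun s => riemannZeta (b₀ * s) * g s) -
        ∑ i, G i, ?_, fun s hs => ?_⟩
    · refine Submodule.sub_mem _ (Submodule.add_mem _ (Submodule.smul_mem _ _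
        (riemannZeta_mul_riemannZeta_mem_zetaProducts h₀ hpos))
        (riemannZeta_mul_mem_zetaProducts h₀ hg)) (Submodule.sum_mem _ fun i _ => ?_)
      rw [← hupsum i]
      exact hG i
    · have hs₀ : 1 < b₀ * s.re := hs 0
      have hs' : ∀ i, 1 < b' i * s.re := fun i => hs i.succ
      have hcons : (fun i (n : ℕ) => 1 / (n : ℂ) ^ ((b i : ℂ) * s)) =
          (Fin.cons (fun n : ℕ => 1 / (n : ℂ) ^ ((b₀ : ℂ) * s))
            (fun i (n : ℕ) => 1 / (n : ℂ) ^ ((b' i : ℂ) * s)) : Fin (k + 1 + 1) → ℕ → ℂ) := by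
        funext i
        refine Fin.cases ?_ (fun j => ?_) i <;> simp [hb₀, hb']
      rw [hcons, injSum_cons _ _ (summable_norm_one_div_cpow hs₀)
        fun i => summable_norm_one_div_cpow (hs' i), hgs s hs',
        ← zeta_eq_tsum_one_div_nat_cpow (by simpa using hs₀)]
      have hterm : ∀ i, injSum (Function.update
          (fun i (n : ℕ) => 1 / (n : ℂ) ^ ((b' i : ℂ) * s)) i
          ((fun n : ℕ => 1 / (n : ℂ) ^ ((b' i : ℂ) * s)) *
            fun n : ℕ => 1 / (n : ℂ) ^ ((b₀ : ℂ) * s))) =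
          (-1) ^ k * (k.factorial : ℂ) * riemannZeta (((b₀ + ∑ i, b' i : ℝ) : ℂ) * s) +
            G i s := by
        intro i
        have hupd : Function.update
          (fun i (n : ℕ) => 1 / (n : ℂ) ^ ((b' i : ℂ) * s)) i
          ((fun n : ℕ => 1 / (n : ℂ) ^ ((b' i : ℂ) * s)) *
            fun n : ℕ => 1 / (n : ℂ) ^ ((b₀ : ℂ) * s)) =
            fun j (n : ℕ) => 1 / (n : ℂ) ^ ((Function.update b' i (b' i + b₀) j : ℂ) * s) := by
          funext j n
          rcases eq_or_ne j i with rfl | h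
          · simp only [Function.update_self, Pi.mul_apply]
            rw [one_div_cpow_mul_one_div_cpow (by simpa using by linarith [hs' j])
              (by simpa using by linarith)]
            push_cast
            rw [add_mul]
          · simp [h]
        rw [hupd, hGs i s fun j => ?_, hupsum i]
        rcases eq_or_ne j i with rfl | h
        · simp only [Function.update_self]
          nlinarith [hs' j]
        · simpa [h] using hs' j
      simp only [hterm, Finset.sum_add_distrib, Finset.sum_const, Finset.card_univ,
        Fintype.card_fin, Pi.add_apply, Pi.sub_apply, Pi.smul_apply, Finset.sum_apply,
        smul_eq_mul, nsmul_eq_mul, Nat.factorial_succ]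
      push_cast
      ring

theorem symmMultiZetaSeries_eq_injSum {r : ℕ} (a : Fin r → ℝ) {s : ℂ}
    (hs : ∀ i, 1 < a i * s.re) :
    symmMultiZetaSeries a s = injSum fun i (n : ℕ) => 1 / (n : ℂ) ^ ((a i : ℂ) * s) := by
  rw [← sum_perm_tsum_strictMono _ fun i => summable_norm_one_div_cpow (hs i),
    symmMultiZetaSeries]
  refine Finset.sum_congr rfl fun τ _ => ?_
  have hinj : Function.Injective fun n : {n : Fin r → ℕ // (∀ j, 1 ≤ n j) ∧ StrictMono n} =>
      (⟨n.1, n.2.2⟩ : {n : Fin r → ℕ // StrictMono n}) := fun x y h =>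
    Subtype.ext (congrArg (fun z : {n : Fin r → ℕ // StrictMono n} => z.1) h)
  rw [multiZetaSeries, ← hinj.tsum_eq]
  · refine tsum_congr fun n => ?_
    simp
  -- A tuple with an entry `0`, allowed in `injSum` but not in the series, contributes `1 / 0 ^ w =
  -- 0`.
  · rintro ⟨n, hn⟩ hx
    have hx' : ∀ j, 1 ≤ n j := by
      by_contra! h
      obtain ⟨j, hj⟩ := h
      have hj0 : n j = 0 := by omega
      refine hx (Finset.prod_eq_zero (Finset.mem_univ j) ?_)
      have h1 : (a (τ j) : ℂ) * s ≠ 0 := fun h => by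
        have := congrArg Complex.re h
        have h2 := hs (τ j)
        simp at this
        rcases this with h | h <;> simp [h] at h2 <;> linarith
      simp [hj0, Complex.zero_cpow h1]
    exact ⟨⟨n, hx', hn⟩, rfl⟩

/-! ### The meromorphic continuation -/

theorem meromorphicAt_riemannZeta (s : ℂ) : MeromorphicAt riemannZeta s := by
  rcases eq_or_ne s 1 with rfl | hs
  · have h1 : (fun s => (completedRiemannZeta₀ s - 1 / s - 1 / (1 - s)) * (Complex.Gammaℝ s)⁻¹)
        =ᶠ[𝓝[≠] (1 : ℂ)] riemannZeta := by
      apply Filter.Eventually.filter_mono nhdsWithin_le_nhds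
      filter_upwards [isOpen_ne.mem_nhds (one_ne_zero : (1 : ℂ) ≠ 0)] with s hs
      rw [riemannZeta_def_of_ne_zero hs, completedRiemannZeta_eq, div_eq_mul_inv _ (Complex.Gammaℝ s)]
    refine MeromorphicAt.congr ?_ h1
    have h2 : MeromorphicAt completedRiemannZeta₀ 1 :=
      (differentiable_completedZeta₀.analyticAt 1).meromorphicAt
    have h3 : MeromorphicAt (fun s => (Complex.Gammaℝ s)⁻¹) 1 :=
      (Complex.differentiable_Gammaℝ_inv.analyticAt 1).meromorphicAt
    exact ((h2.sub ((MeromorphicAt.const 1 _).div (MeromorphicAt.id _))).sub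
      ((MeromorphicAt.const 1 _).div ((MeromorphicAt.const 1 _).sub (MeromorphicAt.id _)))).mul h3
  · exact (analyticOn_riemannZeta s hs).meromorphicAt

theorem meromorphicAt_riemannZeta_mul (b : ℝ) (s : ℂ) :
    MeromorphicAt (fun s : ℂ => riemannZeta (b * s)) s := by
  refine (meromorphicAt_riemannZeta (b * s)).comp_analyticAt (by fun_prop)

theorem analyticAt_riemannZeta_mul {b : ℝ} {s : ℂ} (hs : b * s.re ≠ 1) :
    AnalyticAt ℂ (fun s : ℂ => riemannZeta (b * s)) s := by
  have h : AnalyticAt ℂ riemannZeta (b * s) := analyticOn_riemannZeta _ fun h => hs (by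
    simpa using congrArg Complex.re h)
  exact h.fun_comp (f := fun s : ℂ => (b : ℂ) * s) (by fun_prop)

theorem meromorphicAt_of_mem_zetaProducts {W : ℝ} {g : ℂ → ℂ} (hg : g ∈ zetaProducts W) (s : ℂ) :
    MeromorphicAt g s := by
  induction hg using Submodule.span_induction with
  | mem g hg =>
    obtain ⟨L, hL, -, -, rfl⟩ := hg
    clear * - hL
    induction L with
    | nil => simp
    | cons b L ih =>
      simp only [List.mem_cons, forall_eq_or_imp] at hL
      simpa using! (meromorphicAt_riemannZeta_mul b s).mul (ih hL.2)
  | zero => exact MeromorphicAt.const (0 : ℂ) s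
  | add f g _ _ hf hg => exact hf.add hg
  | smul c g _ hg => exact (MeromorphicAt.const c s).smul hg

/-- The only possible poles are the finitely many points `1 / b > 0`. -/
theorem analyticAt_of_mem_zetaProducts {W : ℝ} {g : ℂ → ℂ} (hg : g ∈ zetaProducts W) :
    (∀ s : ℂ, s.re < 0 → AnalyticAt ℂ g s) ∧
      ∃ c : ℝ, ∀ s : ℂ, c < s.re → AnalyticAt ℂ g s := by
  induction hg using Submodule.span_induction with
  | mem g hg =>
    obtain ⟨L, hL, -, -, rfl⟩ := hg
    clear * - hL
    induction L with
    | nil => exact ⟨fun _ _ => by simp [analyticAt_const], 0, fun _ _ => by simp [analyticAt_const]⟩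
    | cons b L ih =>
      simp only [List.mem_cons, forall_eq_or_imp] at hL
      obtain ⟨h1, c, h2⟩ := ih hL.2
      simp only [List.map_cons, List.prod_cons]
      refine ⟨fun s hs => (analyticAt_riemannZeta_mul ?_).fun_mul (h1 s hs),
        max c (1 / b), fun s hs => (analyticAt_riemannZeta_mul ?_).fun_mul (h2 s ?_)⟩
      · nlinarith [hL.1]
      · have := (div_lt_iff₀ hL.1).1 ((le_max_right _ _).trans_lt hs)
        linarith
      · exact (le_max_left _ _).trans_lt hs
  | zero => exact ⟨fun _ _ => analyticAt_const, 0, fun _ _ => analyticAt_const⟩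
  | add f g _ _ hf hg =>
    obtain ⟨h1, c, h2⟩ := hf
    obtain ⟨h3, d, h4⟩ := hg
    exact ⟨fun s hs => (h1 s hs).add (h3 s hs), max c d, fun s hs =>
      (h2 s ((le_max_left _ _).trans_lt hs)).add (h4 s ((le_max_right _ _).trans_lt hs))⟩
  | smul c g _ hg =>
    obtain ⟨h1, d, h2⟩ := hg
    exact ⟨fun s hs => analyticAt_const.smul (h1 s hs), d, fun s hs =>
      analyticAt_const.smul (h2 s hs)⟩

/-- In the left half-plane `ζ̃` is a non-zero multiple of `ζ(A s)` up to products of at least two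
zeta functions. -/
theorem exists_symmMultiZeta_eq {r : ℕ} (hr : 1 ≤ r) (a : Fin r → ℝ) (ha : ∀ j, 0 < a j) :
    ∃ c : ℂ, c ≠ 0 ∧ ∃ g ∈ zetaProducts (∑ j, a j), ∀ s : ℂ, s.re < 0 →
      AnalyticAt ℂ (symmMultiZeta a) s ∧
      symmMultiZeta a s = c * riemannZeta (((∑ j, a j : ℝ) : ℂ) * s) + g s := by
  obtain ⟨k, rfl⟩ : ∃ k, r = k + 1 := ⟨r - 1, by omega⟩
  obtain ⟨g, hg, hgs⟩ := injSum_eq_riemannZeta_add k a ha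
  set A := ∑ j, a j with hA
  have hApos : 0 < A := Finset.sum_pos (fun i _ => ha i) Finset.univ_nonempty
  set c : ℂ := (-1) ^ k * (k.factorial : ℂ) with hc
  refine ⟨c, by simp [hc, Nat.factorial_ne_zero], g, hg, ?_⟩
  set G : ℂ → ℂ := fun s => c * riemannZeta (A * s) + g s with hG
  have hGm : MeromorphicOn G Set.univ := fun s _ =>
    ((MeromorphicAt.const c s).mul (meromorphicAt_riemannZeta_mul A s)).add
      (meromorphicAt_of_mem_zetaProducts hg s)
  -- Passing to normal form changes nothing near a point where `G` is analytic.
  have hGe : ∀ s, AnalyticAt ℂ G s → toMeromorphicNFOn G Set.univ =ᶠ[𝓝 s] G := fun s hs => by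
    have := toMeromorphicNFOn_eq_toMeromorphicNFAt_on_nhds hGm (Set.mem_univ s)
    rwa [toMeromorphicNFAt_eq_self.2 hs.meromorphicNFAt] at this
  obtain ⟨hgl, d, hgr⟩ := analyticAt_of_mem_zetaProducts hg
  have hGl : ∀ s : ℂ, s.re < 0 → AnalyticAt ℂ G s := fun s hs =>
    (analyticAt_const.mul (analyticAt_riemannZeta_mul (by nlinarith))).add (hgl s hs)
  have hcont : IsMeromorphicContinuation (symmMultiZetaSeries a)
      (toMeromorphicNFOn G Set.univ) := by
    refine ⟨meromorphicNFOn_toMeromorphicNFOn _ _,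
      max d (∑ i, 1 / a i + 1 / A), fun s hs => ?_⟩
    have hle : ∑ i, 1 / a i + 1 / A < s.re := (le_max_right _ _).trans_lt hs
    have hi : ∀ i, 1 < a i * s.re := fun i => by
      have h1 : 1 / a i ≤ ∑ i, 1 / a i :=
        Finset.single_le_sum (f := fun i => 1 / a i)
          (fun j _ => (one_div_pos.2 (ha j)).le) (Finset.mem_univ i)
      have h2 : 1 / a i < s.re := by linarith [one_div_pos.2 hApos]
      rw [div_lt_iff₀ (ha i)] at h2
      linarith
    have hGs : AnalyticAt ℂ G s := by
      refine (analyticAt_const.mul (analyticAt_riemannZeta_mul ?_)).add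
        (hgr s ((le_max_left _ _).trans_lt hs))
      have h1 : 0 ≤ ∑ i, 1 / a i := Finset.sum_nonneg fun j _ => (one_div_pos.2 (ha j)).le
      have h2 : 1 / A < s.re := by linarith
      rw [div_lt_iff₀ hApos] at h2
      linarith
    rw [(hGe s hGs).eq_of_nhds, symmMultiZetaSeries_eq_injSum a hi, hgs s hi]
  have hF : symmMultiZeta a = toMeromorphicNFOn G Set.univ := by
    have h : ∃ F, IsMeromorphicContinuation (symmMultiZetaSeries a) F := ⟨_, hcont⟩
    rw [symmMultiZeta, meromorphicContinuation, dif_pos h]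
    exact h.choose_spec.unique hcont
  intro s hs
  rw [hF]
  exact ⟨(hGl s hs).congr (hGe s (hGl s hs)).symm, (hGe s (hGl s hs)).eq_of_nhds⟩

/-! ### Estimates for the factors of the functional equation -/

theorem riemannZeta_eq_mul_sin {w : ℂ} (hw : w.re < 0) :
    riemannZeta w = Complex.Gammaℂ (1 - w) * riemannZeta (1 - w) *
      Complex.sin (Real.pi * w / 2) := by
  have h := riemannZeta_one_sub (s := 1 - w) (fun n h => ?_) fun h => ?_
  · rw [sub_sub_cancel] at h
    rw [h, Complex.Gammaℂ_def, ← Complex.cos_pi_div_two_sub,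
      show (Real.pi : ℂ) * (1 - w) / 2 = Real.pi / 2 - Real.pi * w / 2 by ring]
    ring
  · have := congrArg Complex.re h
    simp at this
    have h2 : (0 : ℝ) ≤ n := n.cast_nonneg
    linarith
  · have := congrArg Complex.re h
    simp at this
    linarith

/-- Compare the terms `n ≥ 2` with those of `ζ(2) - 1 = π² / 6 - 1`. -/
theorem norm_riemannZeta_sub_one_le {u : ℂ} (hu : 2 ≤ u.re) : ‖riemannZeta u - 1‖ ≤ 3 / 4 := by
  have h2 := hasSum_zeta_two
  have h1 : 1 < u.re := by linarith
  have hs : HasSum (fun n : ℕ => 1 / (n : ℂ) ^ u) (riemannZeta u) := by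
    rw [zeta_eq_tsum_one_div_nat_cpow h1]
    exact (Complex.summable_one_div_nat_cpow.2 h1).hasSum
  have hs' := (hasSum_nat_add_iff' 2).2 hs
  have h2' := (hasSum_nat_add_iff' 2).2 h2
  simp only [Finset.sum_range_succ, Finset.sum_range_zero, Nat.cast_zero, Nat.cast_one,
    Complex.one_cpow, Complex.zero_cpow (Complex.ne_zero_of_one_lt_re h1)] at hs' h2'
  norm_num at hs' h2'
  have hle := hs'.norm_le_of_bounded h2' fun n => by
    rw [norm_inv, show ((n : ℂ) + 2) = ((n + 2 : ℕ) : ℂ) by push_cast; ring,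
      Complex.norm_natCast_cpow_of_pos (by omega)]
    gcongr
    push_cast
    rw [← Real.rpow_natCast]
    exact Real.rpow_le_rpow_of_exponent_le (by linarith [n.cast_nonneg (α := ℝ)])
      (by exact_mod_cast hu)
  have := Real.pi_lt_d2
  nlinarith [Real.pi_pos]

theorem norm_riemannZeta_le {u : ℂ} (hu : 2 ≤ u.re) : ‖riemannZeta u‖ ≤ 2 := by
  have h := norm_le_norm_add_norm_sub (1 : ℂ) (riemannZeta u)
  rw [norm_one, norm_sub_rev] at h
  linarith [norm_riemannZeta_sub_one_le hu]

theorem le_norm_riemannZeta {u : ℂ} (hu : 2 ≤ u.re) : 1 / 4 ≤ ‖riemannZeta u‖ := by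
  have h := norm_le_norm_add_norm_sub (riemannZeta u) (1 : ℂ)
  rw [norm_one] at h
  linarith [norm_riemannZeta_sub_one_le hu]

/-- One of `x`, `1 - x` is at most `1 / 2`, and the power of the other is at most `1`. -/
theorem norm_betaIntegral_le {u v : ℂ} {m : ℝ} (hm : 0 ≤ m) (hu : 1 + m ≤ u.re)
    (hv : 1 + m ≤ v.re) : ‖Complex.betaIntegral u v‖ ≤ (1 / 2 : ℝ) ^ m := by
  have h := intervalIntegral.norm_integral_le_of_norm_le_const_ae (a := 0) (b := 1)
    (C := (1 / 2 : ℝ) ^ m)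
    (f := fun x : ℝ => (x : ℂ) ^ (u - 1) * (1 - (x : ℂ)) ^ (v - 1)) ?_
  · simpa [Complex.betaIntegral] using! h
  · have hne : ∀ᵐ x : ℝ, x ≠ 1 := MeasureTheory.ae_iff.2 (by simp)
    filter_upwards [hne] with x hx1 hx
    rw [Set.uIoc_of_le zero_le_one] at hx
    have h0 : 0 < x := hx.1
    have h1 : 0 < 1 - x := by linarith [lt_of_le_of_ne hx.2 hx1]
    rw [norm_mul, Complex.norm_cpow_eq_rpow_re_of_pos h0,
      show (1 - (x : ℂ)) = ((1 - x : ℝ) : ℂ) by push_cast; ring,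
      Complex.norm_cpow_eq_rpow_re_of_pos h1]
    simp only [Complex.sub_re, Complex.one_re]
    rcases le_total x (1 / 2) with h | h
    · calc x ^ (u.re - 1) * (1 - x) ^ (v.re - 1) ≤ (1 / 2) ^ m * 1 := by
            refine mul_le_mul ?_ (Real.rpow_le_one h1.le (by linarith) (by linarith))
              (by positivity) (by positivity)
            exact (Real.rpow_le_rpow_of_exponent_ge h0 hx.2 (by linarith)).trans
              (Real.rpow_le_rpow h0.le h hm)
        _ = _ := mul_one _
    · calc x ^ (u.re - 1) * (1 - x) ^ (v.re - 1) ≤ 1 * (1 / 2) ^ m := by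
            refine mul_le_mul (Real.rpow_le_one h0.le hx.2 (by linarith)) ?_
              (by positivity) (by positivity)
            exact (Real.rpow_le_rpow_of_exponent_ge h1 (by linarith) (by linarith)).trans
              (Real.rpow_le_rpow h1.le (by linarith) hm)
        _ = _ := one_mul _

theorem sum_range_one_div_add_sq_le {x : ℝ} (hx : 1 < x) (n : ℕ) :
    ∑ j ∈ Finset.range n, 1 / (x + j) ^ 2 ≤ 1 / (x - 1) - 1 / (x - 1 + n) := by
  induction n with
  | zero => simp
  | succ n ih =>
    have hn : (0 : ℝ) ≤ n := n.cast_nonneg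
    have h1 : 0 < x + n := by linarith
    have h2 : 0 < x - 1 + n := by linarith
    rw [Finset.sum_range_succ]
    have : 1 / (x + n) ^ 2 ≤ 1 / (x - 1 + n) - 1 / (x - 1 + (n + 1 : ℕ)) := by
      push_cast
      rw [show x - 1 + ((n : ℝ) + 1) = x + n by ring, div_sub_div _ _ h2.ne' h1.ne',
        div_le_div_iff₀ (by positivity) (by positivity)]
      nlinarith
    linarith

/-- Along the parabolas `t ^ 2 ≪ σ` the Gamma function is as large as on the real axis. -/
theorem le_norm_Gamma {u : ℂ} (hu : 1 < u.re) :
    Real.Gamma u.re * Real.exp (-(u.im ^ 2 / (2 * (u.re - 1)))) ≤ ‖Complex.Gamma u‖ := by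
  -- Compare Euler's approximants `n ^ u n! / ∏ (u + j)` with those at the real point `u.re`; each
  -- factor obeys `1 + y² / (x + j)² ≤ exp(y² / (x + j)²)`, and the exponents telescope.
  refine le_of_tendsto_of_tendsto ((Real.GammaSeq_tendsto_Gamma u.re).mul_const _)
    (Complex.GammaSeq_tendsto_Gamma u).norm ?_
  filter_upwards [eventually_ge_atTop 1] with n hn
  set x := u.re with hx
  set y := u.im with hy
  have hpos : ∀ j : ℕ, 0 < x + j := fun j => by linarith [j.cast_nonneg (α := ℝ)]
  have hfac : ∀ j : ℕ, ‖u + j‖ ≤ (x + j) * Real.exp (y ^ 2 / 2 * (1 / (x + j) ^ 2)) := by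
    intro j
    have h1 : ‖u + j‖ ^ 2 = (x + j) ^ 2 + y ^ 2 := by
      rw [Complex.sq_norm, Complex.normSq_apply]
      simp [← hx, ← hy]; ring
    refine le_of_sq_le_sq ?_ (by have := hpos j; positivity)
    rw [h1, mul_pow, ← Real.exp_nat_mul]
    have h2 : y ^ 2 / (x + j) ^ 2 + 1 ≤ Real.exp (y ^ 2 / (x + j) ^ 2) := Real.add_one_le_exp _
    have h3 : ((2 : ℕ) : ℝ) * (y ^ 2 / 2 * (1 / (x + j) ^ 2)) = y ^ 2 / (x + j) ^ 2 := by
      push_cast; ring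
    rw [h3]
    calc (x + j) ^ 2 + y ^ 2 = (x + j) ^ 2 * (y ^ 2 / (x + j) ^ 2 + 1) := by
          have := (hpos j).ne'; field_simp; ring
      _ ≤ _ := by gcongr
  have hprod : ∏ j ∈ Finset.range (n + 1), ‖u + j‖ ≤
      (∏ j ∈ Finset.range (n + 1), (x + j)) * Real.exp (y ^ 2 / (2 * (x - 1))) := by
    calc _ ≤ ∏ j ∈ Finset.range (n + 1),
            ((x + j) * Real.exp (y ^ 2 / 2 * (1 / (x + j) ^ 2))) :=
          Finset.prod_le_prod (fun _ _ => norm_nonneg _) fun j _ => hfac j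
      _ = (∏ j ∈ Finset.range (n + 1), (x + j)) *
            Real.exp (y ^ 2 / 2 * ∑ j ∈ Finset.range (n + 1), 1 / (x + j) ^ 2) := by
          rw [Finset.prod_mul_distrib, ← Real.exp_sum, Finset.mul_sum]
      _ ≤ _ := by
          have hnn : 0 ≤ ∏ j ∈ Finset.range (n + 1), (x + j) :=
            Finset.prod_nonneg fun j _ => (hpos j).le
          gcongr
          have h := sum_range_one_div_add_sq_le hu (n + 1)
          have h' : 0 ≤ 1 / (x - 1 + (n + 1 : ℕ)) :=
            one_div_nonneg.2 (by push_cast; linarith [n.cast_nonneg (α := ℝ)])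
          calc _ ≤ y ^ 2 / 2 * (1 / (x - 1)) := by gcongr; linarith
            _ = _ := by rw [div_mul_div_comm, mul_one]
  have hP : 0 < ∏ j ∈ Finset.range (n + 1), (x + j) := Finset.prod_pos fun j _ => hpos j
  have hQ : 0 < ∏ j ∈ Finset.range (n + 1), ‖u + j‖ := Finset.prod_pos fun j _ => by
    refine norm_pos_iff.2 fun h => (hpos j).ne' ?_
    simpa using congrArg Complex.re h
  rw [Real.GammaSeq, Complex.GammaSeq, norm_div, norm_mul, norm_prod, Complex.norm_natCast,
    Complex.norm_natCast_cpow_of_pos hn, Real.exp_neg, ← div_eq_mul_inv, div_div]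
  gcongr

theorem tendsto_rpow_mul_Gamma {c : ℝ} (hc : 0 < c) :
    Tendsto (fun x : ℝ => c ^ (-x) * Real.Gamma x) atTop atTop := by
  set d := max c 1 with hd
  have hd1 : 1 ≤ d := le_max_right _ _
  have hcd : c ≤ d := le_max_left _ _
  have hd0 : 0 < d := by linarith
  have h1 : Tendsto (fun n : ℕ => d ^ n / n.factorial) atTop (𝓝[>] 0) := by
    refine tendsto_nhdsWithin_iff.2 ⟨FloorSemiring.tendsto_pow_div_factorial_atTop d,
      Eventually.of_forall fun n => by simp only [Set.mem_Ioi]; positivity⟩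
  have h2 := h1.inv_tendsto_nhdsGT_zero.comp
    ((tendsto_nat_floor_atTop (α := ℝ)).comp (tendsto_atTop_add_const_right atTop (-1 : ℝ) tendsto_id))
  refine tendsto_atTop_mono' _ ?_ (h2.const_mul_atTop (show 0 < (d ^ 2)⁻¹ by positivity))
  filter_upwards [eventually_ge_atTop 3] with x hx
  simp only [Function.comp_apply, id_eq, Pi.inv_apply, inv_div]
  -- Thus `n + 1 ≤ x < n + 2`, and `x ≥ 3` puts `n + 1` in the range `[2, ∞)` where Gamma increases.
  set n := ⌊x + -1⌋₊ with hn
  have hn1 : (n : ℝ) ≤ x + -1 := Nat.floor_le (by linarith)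
  have hn2 : x + -1 < n + 1 := Nat.lt_floor_add_one _
  have h3 : (n.factorial : ℝ) ≤ Real.Gamma x := by
    rw [← Real.Gamma_nat_eq_factorial]
    exact Real.Gamma_strictMonoOn_Ici.monotoneOn (Set.mem_Ici.2 (by linarith))
      (Set.mem_Ici.2 (by linarith)) (by linarith)
  have h4 : c ^ x ≤ d ^ 2 * d ^ n := by
    calc c ^ x ≤ d ^ x := Real.rpow_le_rpow hc.le hcd (by linarith)
      _ ≤ d ^ ((2 + n : ℕ) : ℝ) := Real.rpow_le_rpow_of_exponent_le hd1 (by push_cast; linarith)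
      _ = d ^ 2 * d ^ n := by rw [Real.rpow_natCast, pow_add]
  rw [Real.rpow_neg hc.le]
  calc (d ^ 2)⁻¹ * (n.factorial / d ^ n) = (d ^ 2 * d ^ n)⁻¹ * n.factorial := by
        rw [mul_inv]; ring
    _ ≤ _ := by gcongr

/-! ### Asymptotics in the parabolic regions -/

theorem norm_sin_le_exp (z : ℂ) : ‖Complex.sin z‖ ≤ Real.exp |z.im| := by
  have h1 : ‖Complex.exp (-z * Complex.I)‖ ≤ Real.exp |z.im| := by
    rw [Complex.norm_exp]; simpa using le_abs_self _
  have h2 : ‖Complex.exp (z * Complex.I)‖ ≤ Real.exp |z.im| := by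
    rw [Complex.norm_exp]; simpa using neg_le_abs _
  rw [Complex.sin, norm_div, norm_mul, Complex.norm_I, mul_one, Complex.norm_two]
  have h3 := norm_sub_le (Complex.exp (-z * Complex.I)) (Complex.exp (z * Complex.I))
  linarith

/-- The filter of the regions `σ ≤ min {C, -p t²}` as `C → -∞`. -/
def leftParabola (p : ℝ) : Filter ℂ :=
  comap Complex.re atBot ⊓ 𝓟 {s | s.re ≤ -p * s.im ^ 2}

theorem eventually_leftParabola_iff {p : ℝ} {P : ℂ → Prop} :
    (∀ᶠ s in leftParabola p, P s) ↔ ∃ C : ℝ, ∀ s ∈ parabolicRegion C p, P s := by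
  rw [leftParabola, eventually_inf_principal, eventually_comap, eventually_atBot]
  constructor
  · rintro ⟨C, h⟩
    refine ⟨C, fun s (hs : s.re ≤ min C (-p * s.im ^ 2)) => ?_⟩
    exact h s.re (hs.trans (min_le_left _ _)) s rfl (hs.trans (min_le_right _ _))
  · rintro ⟨C, h⟩
    exact ⟨C, fun x hx s hs hp => h s (le_min (hs ▸ hx) hp)⟩

theorem tendsto_re_leftParabola (p : ℝ) : Tendsto Complex.re (leftParabola p) atBot :=
  tendsto_comap.mono_left inf_le_left

theorem eventually_le_leftParabola (p : ℝ) :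
    ∀ᶠ s : ℂ in leftParabola p, s.re ≤ -p * s.im ^ 2 :=
  mem_inf_of_right (mem_principal_self _)

theorem tendsto_norm_mul_exp_leftParabola {p m : ℝ} (hp : 0 < p) (hm : 0 < m) (c : ℝ) :
    Tendsto (fun s : ℂ => (1 + ‖s‖) * Real.exp (c * |s.im|) * Real.exp (m * s.re))
      (leftParabola p) (𝓝 0) := by
  set K := Real.exp (c ^ 2 / (2 * m * p)) with hK
  have h1 : Tendsto (fun x : ℝ => (2 + (1 + 1 / p) * x) * K * Real.exp (-(m / 2) * x))
      atTop (𝓝 0) := by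
    have e0 := tendsto_rpow_mul_exp_neg_mul_atTop_nhds_zero 0 (m / 2) (by positivity)
    have e1 := tendsto_rpow_mul_exp_neg_mul_atTop_nhds_zero 1 (m / 2) (by positivity)
    simp only [Real.rpow_zero, Real.rpow_one] at e0 e1
    have := (e0.const_mul (2 * K)).add (e1.const_mul ((1 + 1 / p) * K))
    simp only [mul_zero, add_zero] at this
    refine this.congr fun x => ?_
    ring
  have h2 := h1.comp (tendsto_neg_atBot_atTop.comp (tendsto_re_leftParabola p))
  refine squeeze_zero' (Eventually.of_forall fun s => by positivity) ?_ h2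
  filter_upwards [eventually_le_leftParabola p,
    (tendsto_re_leftParabola p).eventually (eventually_le_atBot 0)] with s hs h0
  simp only [Function.comp_apply]
  have hy : s.im ^ 2 ≤ 1 / p * -s.re := by
    rw [one_div, ← div_eq_inv_mul, le_div_iff₀ hp]; linarith
  have hn : ‖s‖ ≤ -s.re + |s.im| := by
    have := Complex.norm_le_abs_re_add_abs_im s
    rwa [abs_of_nonpos h0] at this
  have hy1 : |s.im| ≤ 1 + s.im ^ 2 := by
    rw [← sq_abs]; nlinarith [sq_nonneg (|s.im| - 1), abs_nonneg s.im]
  -- Completing the square: `t ^ 2 ≤ |σ| / p` then lets half of the decay `m * s.re` absorb `c *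
  -- |t|` up to a constant.
  have hc : c * |s.im| ≤ m * p / 2 * s.im ^ 2 + c ^ 2 / (2 * m * p) := by
    have e : m * p / 2 * s.im ^ 2 + c ^ 2 / (2 * m * p) - c * |s.im| =
        (m * p * |s.im| - c) ^ 2 / (2 * m * p) := by
      rw [← sq_abs s.im]; field_simp; ring
    have : 0 ≤ (m * p * |s.im| - c) ^ 2 / (2 * m * p) := by positivity
    linarith
  have hc' : c * |s.im| + m * s.re ≤ c ^ 2 / (2 * m * p) + -(m / 2) * -s.re := by
    have : m / 2 * (p * s.im ^ 2) ≤ m / 2 * -s.re := by gcongr; linarith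
    linarith
  rw [mul_assoc, ← Real.exp_add, mul_assoc _ K, hK, ← Real.exp_add]
  have : 1 + ‖s‖ ≤ 2 + (1 + 1 / p) * -s.re := by linarith
  have h3 : 0 ≤ 2 + (1 + 1 / p) * -s.re := by linarith [norm_nonneg s]
  gcongr

/-- The analytic factor of the functional equation `ζ(1 - u) = cos(πu/2) * dualZeta u`. -/
noncomputable def dualZeta (u : ℂ) : ℂ := Complex.Gammaℂ u * riemannZeta u

theorem dualZeta_ne_zero {u : ℂ} (hu : 1 < u.re) : dualZeta u ≠ 0 := by
  refine mul_ne_zero ?_ (riemannZeta_ne_zero_of_one_lt_re hu)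
  rw [Complex.Gammaℂ_def]
  have h2 : (2 * Real.pi : ℂ) ≠ 0 := by simp [Real.pi_ne_zero]
  exact mul_ne_zero (mul_ne_zero two_ne_zero (by simp [Complex.cpow_eq_zero_iff, h2]))
    (Complex.Gamma_ne_zero_of_re_pos (by linarith))

theorem Gammaℂ_mul_Gammaℂ {u v : ℂ} (hu : 0 < u.re) (hv : 0 < v.re) :
    Complex.Gammaℂ u * Complex.Gammaℂ v =
      2 * Complex.betaIntegral u v * Complex.Gammaℂ (u + v) := by
  have h2 : (2 * Real.pi : ℂ) ≠ 0 := by simp [Real.pi_ne_zero]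
  simp only [Complex.Gammaℂ_def]
  rw [neg_add, Complex.cpow_add _ _ h2]
  linear_combination 4 * (2 * (Real.pi : ℂ)) ^ (-u) * (2 * (Real.pi : ℂ)) ^ (-v) *
    Complex.Gamma_mul_Gamma_eq_betaIntegral hu hv

/-- As `u + v = w + 1`, the Gamma factors give `B(u, v)` times `Gammaℂ w` times a multiple of `w`.
The beta integral supplies the exponential decay, and the zeta values lie between `1 / 4` and `2` in
norm. -/
theorem norm_dualZeta_mul_le {b W : ℝ} (hb : 0 < b) (hW : 0 < W) {s : ℂ}
    (h1 : 1 ≤ b * -s.re) (h2 : 1 ≤ W * -s.re) :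
    ‖dualZeta (1 - b * s)‖ * ‖dualZeta (1 - W * s)‖ ≤
      16 * (1 + b + W) * ((1 + ‖s‖) * Real.exp (Real.log 2 * min b W * s.re)) *
        ‖dualZeta (1 - ((b + W : ℝ) : ℂ) * s)‖ := by
  have hx : 0 < -s.re := by
    by_contra! h
    nlinarith
  set u : ℂ := 1 - b * s with hu
  set v : ℂ := 1 - W * s with hv
  set w : ℂ := 1 - ((b + W : ℝ) : ℂ) * s with hw
  have hure : u.re = 1 + b * -s.re := by simp [hu]; ring
  have hvre : v.re = 1 + W * -s.re := by simp [hv]; ring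
  have hwre : w.re = 1 + (b + W) * -s.re := by simp [hw]; ring
  have huv : u + v = w + 1 := by simp only [hu, hv, hw]; push_cast; ring
  have hw0 : w ≠ 0 := fun h => by
    rw [h, Complex.zero_re] at hwre
    linarith
  have hG := Gammaℂ_mul_Gammaℂ (u := u) (v := v) (by linarith) (by linarith)
  rw [huv, Complex.Gammaℂ_add_one hw0] at hG
  have hG' := congrArg norm hG
  simp only [norm_mul, norm_div, Complex.norm_two, Complex.norm_real, Real.norm_eq_abs,
    abs_of_pos Real.pi_pos] at hG'
  have hβ := norm_betaIntegral_le (u := u) (v := v) (m := min b W * -s.re)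
    (mul_nonneg (le_min hb.le hW.le) hx.le)
    (by rw [hure]; gcongr; exact min_le_left _ _)
    (by rw [hvre]; gcongr; exact min_le_right _ _)
  have hpow : (1 / 2 : ℝ) ^ (min b W * -s.re) = Real.exp (Real.log 2 * min b W * s.re) := by
    rw [Real.rpow_def_of_pos (by norm_num), one_div, Real.log_inv]
    ring_nf
  rw [hpow] at hβ
  have hwn : ‖w‖ ≤ (1 + b + W) * (1 + ‖s‖) := by
    calc ‖w‖ ≤ ‖(1 : ℂ)‖ + ‖((b + W : ℝ) : ℂ) * s‖ := norm_sub_le _ _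
      _ = 1 + (b + W) * ‖s‖ := by
          rw [norm_one, norm_mul, Complex.norm_real, Real.norm_of_nonneg (by positivity)]
      _ ≤ _ := by nlinarith [norm_nonneg s]
  have hζu := norm_riemannZeta_le (u := u) (by linarith)
  have hζv := norm_riemannZeta_le (u := v) (by linarith)
  have hζw := le_norm_riemannZeta (u := w) (by nlinarith)
  have hπ := Real.two_le_pi
  set E := Real.exp (Real.log 2 * min b W * s.re)
  simp only [dualZeta, norm_mul]
  calc _ = (‖Complex.Gammaℂ u‖ * ‖Complex.Gammaℂ v‖) * (‖riemannZeta u‖ * ‖riemannZeta v‖) := by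
        ring
    _ = (2 * ‖Complex.betaIntegral u v‖ * ‖Complex.Gammaℂ w‖ * (‖w‖ / 2 / Real.pi)) *
          (‖riemannZeta u‖ * ‖riemannZeta v‖) := by rw [hG']; ring
    _ ≤ (2 * E * ‖Complex.Gammaℂ w‖ * ((1 + b + W) * (1 + ‖s‖) / 2)) * (2 * 2) := by
        gcongr
        linarith [norm_nonneg w]
    _ = 16 * (1 + b + W) * ((1 + ‖s‖) * E) * (‖Complex.Gammaℂ w‖ * (1 / 4)) := by ring
    _ ≤ _ := by gcongr

theorem dualZeta_mul_isLittleO {p b W : ℝ} (hp : 0 < p) (hb : 0 < b) (hW : 0 < W) (c : ℝ) :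
    (fun s : ℂ => Real.exp (c * |s.im|) * (‖dualZeta (1 - b * s)‖ * ‖dualZeta (1 - W * s)‖))
      =o[leftParabola p] fun s : ℂ => dualZeta (1 - ((b + W : ℝ) : ℂ) * s) := by
  have hm : 0 < Real.log 2 * min b W := mul_pos (Real.log_pos one_lt_two) (lt_min hb hW)
  have h0 := (tendsto_norm_mul_exp_leftParabola hp hm c).const_mul (16 * (1 + b + W))
  rw [mul_zero] at h0
  have h1 := ((isLittleO_one_iff ℝ).2 h0).mul_isBigO
    (isBigO_refl (fun s : ℂ => ‖dualZeta (1 - ((b + W : ℝ) : ℂ) * s)‖) (leftParabola p))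
  simp only [one_mul] at h1
  refine (IsBigO.of_bound 1 ?_).trans_isLittleO (isLittleO_norm_right.1 h1)
  have hre := tendsto_re_leftParabola p
  filter_upwards [hre.eventually (eventually_le_atBot (-(1 / b))),
    hre.eventually (eventually_le_atBot (-(1 / W)))] with s h1 h2
  have h1' : 1 ≤ b * -s.re := by
    have : 1 / b ≤ -s.re := by linarith
    rwa [div_le_iff₀' hb] at this
  have h2' : 1 ≤ W * -s.re := by
    have : 1 / W ≤ -s.re := by linarith
    rwa [div_le_iff₀' hW] at this
  rw [one_mul, Real.norm_of_nonneg (by positivity), Real.norm_of_nonneg (by positivity)]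
  calc _ ≤ Real.exp (c * |s.im|) * _ :=
        mul_le_mul_of_nonneg_left (norm_dualZeta_mul_le hb hW h1' h2') (Real.exp_pos _).le
    _ = _ := by ring

theorem riemannZeta_mul_isBigO {p b : ℝ} (hb : 0 < b) :
    (fun s : ℂ => riemannZeta (b * s)) =O[leftParabola p]
      fun s : ℂ => Real.exp (Real.pi * b / 2 * |s.im|) * ‖dualZeta (1 - b * s)‖ := by
  refine IsBigO.of_bound 1 ?_
  filter_upwards [(tendsto_re_leftParabola p).eventually (eventually_lt_atBot 0)] with s hs
  have hbs : ((b : ℂ) * s).re < 0 := by simpa using mul_neg_of_pos_of_neg hb hs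
  rw [riemannZeta_eq_mul_sin hbs, norm_mul, one_mul, Real.norm_of_nonneg (by positivity), mul_comm,
    dualZeta]
  gcongr
  refine (norm_sin_le_exp _).trans (Real.exp_le_exp.2 (le_of_eq ?_))
  rw [show (Real.pi : ℂ) * (b * s) / 2 = ((Real.pi * b / 2 : ℝ) : ℂ) * s by push_cast; ring,
    Complex.im_ofReal_mul, abs_mul,
    abs_of_pos (by positivity)]

/-- The weaker bound, with its exponential loss from the sines, is what a single factor satisfies
and what the induction needs; from two factors on, the beta decay absorbs the loss. -/
theorem list_prod_riemannZeta_isBigO {p : ℝ} (hp : 0 < p) (L : List ℝ) (hL : ∀ b ∈ L, 0 < b)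
    (hne : L ≠ []) :
    (fun s : ℂ => (L.map fun b : ℝ => riemannZeta (b * s)).prod) =O[leftParabola p]
        (fun s : ℂ => Real.exp (Real.pi * L.sum / 2 * |s.im|) * ‖dualZeta (1 - L.sum * s)‖) ∧
      (2 ≤ L.length → (fun s : ℂ => (L.map fun b : ℝ => riemannZeta (b * s)).prod)
        =o[leftParabola p] fun s : ℂ => dualZeta (1 - L.sum * s)) := by
  induction L with
  | nil => exact absurd rfl hne
  | cons b L ih =>
    simp only [List.mem_cons, forall_eq_or_imp] at hL
    rcases eq_or_ne L [] with rfl | hne'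
    · simpa using riemannZeta_mul_isBigO hL.1
    · have hW : 0 < L.sum := List.sum_pos L hL.2 hne'
      have h := (riemannZeta_mul_isBigO (p := p) hL.1).mul (ih hL.2 hne').1
      have h' := dualZeta_mul_isLittleO hp hL.1 hW (Real.pi * b / 2 + Real.pi * L.sum / 2)
      have key : (fun s : ℂ => ((b :: L).map fun b : ℝ => riemannZeta (b * s)).prod)
          =o[leftParabola p] fun s : ℂ => dualZeta (1 - (b :: L).sum * s) := by
        simp only [List.map_cons, List.prod_cons, List.sum_cons]
        refine h.trans_isLittleO (h'.congr_left fun s => ?_)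
        rw [add_mul, Real.exp_add]
        ring
      refine ⟨key.isBigO.trans (IsBigO.of_bound 1 (Eventually.of_forall fun s => ?_)), fun _ => key⟩
      have hs : 0 ≤ (b :: L).sum := by rw [List.sum_cons]; linarith [hL.1]
      have hexp : 1 ≤ Real.exp (Real.pi * (b :: L).sum / 2 * |s.im|) :=
        Real.one_le_exp (by have := Real.pi_pos; positivity)
      rw [one_mul, Real.norm_of_nonneg (by positivity)]
      exact le_mul_of_one_le_left (norm_nonneg _) hexp

theorem isLittleO_of_mem_zetaProducts {p W : ℝ} (hp : 0 < p) {g : ℂ → ℂ}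
    (hg : g ∈ zetaProducts W) : g =o[leftParabola p] fun s : ℂ => dualZeta (1 - W * s) := by
  induction hg using Submodule.span_induction with
  | mem g hg =>
    obtain ⟨L, hL, rfl, hl, rfl⟩ := hg
    exact (list_prod_riemannZeta_isBigO hp L hL (by rintro rfl; simp at hl)).2 hl
  | zero => exact isLittleO_zero _ _
  | add f g _ _ hf hg => exact hf.add hg
  | smul c g _ hg => exact hg.const_smul_left c

theorem tendsto_norm_dualZeta {p A : ℝ} (hp : 0 < p) (hA : 0 < A) :
    Tendsto (fun s : ℂ => ‖dualZeta (1 - A * s)‖) (leftParabola p) atTop := by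
  have hre := tendsto_re_leftParabola p
  have h1 : Tendsto (fun s : ℂ => 1 + A * -s.re) (leftParabola p) atTop :=
    tendsto_atTop_add_const_left _ _
      ((tendsto_neg_atBot_atTop.comp hre).const_mul_atTop hA)
  have h2 := ((tendsto_rpow_mul_Gamma Real.two_pi_pos).comp h1).const_mul_atTop
    (show 0 < Real.exp (-(A / (2 * p))) / 2 by positivity)
  refine tendsto_atTop_mono' _ ?_ h2
  filter_upwards [hre.eventually (eventually_le_atBot (-(1 / A))),
    eventually_le_leftParabola p, hre.eventually (eventually_lt_atBot 0)] with s hs hsp hneg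
  have hx : 1 ≤ A * -s.re := by
    have : 1 / A ≤ -s.re := by linarith
    rwa [div_le_iff₀' hA] at this
  set u : ℂ := 1 - A * s with hu
  have hure : u.re = 1 + A * -s.re := by simp [hu]; ring
  have huim : u.im = -(A * s.im) := by simp [hu]
  have hΓ := le_norm_Gamma (u := u) (by linarith)
  have hζ := le_norm_riemannZeta (u := u) (by linarith)
  -- The loss in `le_norm_Gamma` is `A t² / (2 |σ|)`, at most `A / (2 p)` in the parabola.
  have hexp : Real.exp (-(A / (2 * p))) ≤ Real.exp (-(u.im ^ 2 / (2 * (u.re - 1)))) := by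
    refine Real.exp_le_exp.2 (neg_le_neg ?_)
    rw [huim, hure, add_sub_cancel_left, div_le_div_iff₀ (by positivity) (by positivity)]
    nlinarith [mul_le_mul_of_nonneg_left hsp (show 0 ≤ 2 * A ^ 2 by positivity)]
  have hΓ0 : 0 ≤ Real.Gamma u.re := Real.Gamma_nonneg_of_nonneg (by linarith)
  simp only [Function.comp_apply]
  rw [dualZeta, norm_mul, Complex.Gammaℂ_def, norm_mul, norm_mul, Complex.norm_two, ← hure,
    show (2 * Real.pi : ℂ) = ((2 * Real.pi : ℝ) : ℂ) by push_cast; rfl,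
    Complex.norm_cpow_eq_rpow_re_of_pos Real.two_pi_pos, Complex.neg_re]
  have hpow : 0 < (2 * Real.pi) ^ (-u.re) := Real.rpow_pos_of_pos Real.two_pi_pos _
  calc _ = 2 * (2 * Real.pi) ^ (-u.re) * (Real.Gamma u.re * Real.exp (-(A / (2 * p)))) *
          (1 / 4) := by ring
    _ ≤ _ := by
        gcongr
        exact (mul_le_mul_of_nonneg_left hexp hΓ0).trans hΓ

theorem const_isLittleO_dualZeta {p A : ℝ} (hp : 0 < p) (hA : 0 < A) (α : ℂ) :
    (fun _ : ℂ => α) =o[leftParabola p] fun s : ℂ => dualZeta (1 - A * s) :=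
  isLittleO_const_left.2 (Or.inr (tendsto_norm_dualZeta hp hA))

/-! ### Zeros of small perturbations of the sine -/

/-- From `|sin z|² = sin² x + sinh² y`, Jordan's inequality and `|y| ≤ |sinh y|`. -/
theorem mul_norm_le_norm_sin {z : ℂ} (hz : |z.re| ≤ Real.pi / 2) :
    2 / Real.pi * ‖z‖ ≤ ‖Complex.sin z‖ := by
  have hsin : ‖Complex.sin z‖ ^ 2 = Real.sin z.re ^ 2 + Real.sinh z.im ^ 2 := by
    have h1 : Complex.sin z = ((Real.sin z.re * Real.cosh z.im : ℝ) : ℂ) +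
        ((Real.cos z.re * Real.sinh z.im : ℝ) : ℂ) * Complex.I := by
      rw [Complex.sin_eq z]; push_cast; ring
    rw [h1, Complex.sq_norm, Complex.normSq_add_mul_I]
    have h2 := Real.cosh_sq z.im
    have h3 := Real.sin_sq_add_cos_sq z.re
    linear_combination Real.sin z.re ^ 2 * h2 + Real.sinh z.im ^ 2 * h3
  have h1 := Real.mul_abs_le_abs_sin hz
  have h2 : |z.im| ≤ |Real.sinh z.im| := by
    rw [Real.abs_sinh]; exact Real.self_le_sinh_iff.2 (abs_nonneg _)
  have hπ : 2 / Real.pi ≤ 1 := (div_le_one Real.pi_pos).2 Real.two_le_pi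
  have hπ0 : 0 ≤ 2 / Real.pi := by have := Real.pi_pos; positivity
  have h3 : 2 / Real.pi * |z.im| ≤ |Real.sinh z.im| :=
    (mul_le_of_le_one_left (abs_nonneg _) hπ).trans h2
  refine le_of_sq_le_sq ?_ (norm_nonneg _)
  rw [hsin, mul_pow, Complex.sq_norm, Complex.normSq_apply, ← sq_abs (Real.sin z.re),
    ← sq_abs (Real.sinh z.im)]
  have h4 := pow_le_pow_left₀ (by positivity) h1 2
  have h5 := pow_le_pow_left₀ (by positivity) h3 2
  rw [mul_pow, sq_abs] at h4 h5
  linarith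

theorem norm_cos_sub_one_le {z : ℂ} (hz : ‖z‖ ≤ 1) : ‖Complex.cos z - 1‖ ≤ 2 * ‖z‖ := by
  have h1 : ‖Complex.exp (z * Complex.I) - 1‖ ≤ 2 * ‖z‖ := by
    simpa using Complex.norm_exp_sub_one_le (x := z * Complex.I) (by simpa using hz)
  have h2 : ‖Complex.exp (-z * Complex.I) - 1‖ ≤ 2 * ‖z‖ := by
    simpa using Complex.norm_exp_sub_one_le (x := -z * Complex.I) (by simpa using hz)
  have h3 : Complex.cos z - 1 =
      ((Complex.exp (z * Complex.I) - 1) + (Complex.exp (-z * Complex.I) - 1)) / 2 := by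
    rw [Complex.cos]; ring
  rw [h3, norm_div, Complex.norm_two]
  linarith [norm_add_le (Complex.exp (z * Complex.I) - 1) (Complex.exp (-z * Complex.I) - 1)]

/-- The map `z - f z` contracts by `1 / 2` and moves the centre by at most `ε / 2`, so it preserves
the closed ball; its fixed points are the zeros of `f`. -/
theorem existsUnique_zero_of_norm_deriv_sub_one_le {f f' : ℂ → ℂ} {z₀ : ℂ} {ε : ℝ} (hε : 0 ≤ ε)
    (hd : ∀ z ∈ Metric.closedBall z₀ ε, HasDerivAt f (f' z) z)
    (hf' : ∀ z ∈ Metric.closedBall z₀ ε, ‖f' z - 1‖ ≤ 1 / 2) (h₀ : ‖f z₀‖ ≤ ε / 2) :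
    ∃! z, z ∈ Metric.closedBall z₀ ε ∧ f z = 0 := by
  set T : ℂ → ℂ := fun z => z - f z with hT
  have hlip : ∀ x ∈ Metric.closedBall z₀ ε, ∀ y ∈ Metric.closedBall z₀ ε,
      ‖T y - T x‖ ≤ 1 / 2 * ‖y - x‖ := fun x hx y hy =>
    (convex_closedBall z₀ ε).norm_image_sub_le_of_norm_hasDerivWithin_le
      (f' := fun z => 1 - f' z)
      (fun z hz => ((hasDerivAt_id z).sub (hd z hz)).hasDerivWithinAt)
      (fun z hz => by rw [norm_sub_rev]; exact hf' z hz) hx hy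
  have hz₀ : z₀ ∈ Metric.closedBall z₀ ε := Metric.mem_closedBall_self hε
  have hmaps : Set.MapsTo T (Metric.closedBall z₀ ε) (Metric.closedBall z₀ ε) := fun z hz => by
    have h1 := hlip z₀ hz₀ z hz
    have hz' : ‖z - z₀‖ ≤ ε := by simpa [dist_eq_norm] using hz
    rw [mem_closedBall_iff_norm]
    calc ‖T z - z₀‖ = ‖(T z - T z₀) - f z₀‖ := by simp only [hT]; congr 1; ring
      _ ≤ ‖T z - T z₀‖ + ‖f z₀‖ := norm_sub_le _ _
      _ ≤ ε := by linarith
  have hc : ContractingWith (1 / 2) (hmaps.restrict T _ _) := by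
    refine ⟨by norm_num, LipschitzWith.of_dist_le_mul fun x y => ?_⟩
    have := hlip y.1 y.2 x.1 x.2
    simpa [Subtype.dist_eq, dist_eq_norm] using this
  obtain ⟨z, hz, hfix, -⟩ := hc.exists_fixedPoint' Metric.isClosed_closedBall.isComplete hmaps hz₀
    (edist_ne_top _ _)
  refine ⟨z, ⟨hz, by simpa [hT, Function.IsFixedPt] using hfix⟩, fun w ⟨hw, hfw⟩ => ?_⟩
  have hfz : f z = 0 := by simpa [hT, Function.IsFixedPt] using hfix
  have h := hlip z hz w hw
  simp only [hT, hfz, hfw, sub_zero] at h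
  have : ‖w - z‖ = 0 := by linarith [norm_nonneg (w - z)]
  exact sub_eq_zero.1 (norm_eq_zero.1 this)

theorem pi_mul_div_two_eq {A : ℝ} (hA : 0 < A) (n : ℕ) (s : ℂ) :
    (Real.pi : ℂ) * (A * s) / 2 =
      (Real.pi * A / 2 : ℝ) * (s + 2 * (n : ℂ) / (A : ℂ)) - n * Real.pi := by
  have : (A : ℂ) ≠ 0 := Complex.ofReal_ne_zero.2 hA.ne'
  push_cast
  field_simp
  ring

theorem le_norm_sin_of_forall_lt {A ε : ℝ} (hA : 0 < A) {s : ℂ} (hs : A * s.re ≤ -2)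
    (h : ∀ n : ℕ, 1 ≤ n → ε < ‖s + 2 * (n : ℂ) / (A : ℂ)‖) :
    A * ε < ‖Complex.sin (Real.pi * (A * s) / 2)‖ := by
  have hπ := Real.pi_pos
  set x := -(A * s.re / 2) with hx
  have hx1 : 1 ≤ x := by linarith
  -- The integer nearest to `-A σ / 2`: subtracting this zero brings the real part of the argument
  -- into `[-π/2, π/2]`.
  set n := ⌊x + 1 / 2⌋₊ with hn
  have hn1 : (n : ℝ) ≤ x + 1 / 2 := Nat.floor_le (by linarith)
  have hn2 : x + 1 / 2 < n + 1 := Nat.lt_floor_add_one _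
  have hn0 : 1 ≤ n := Nat.le_floor (by push_cast; linarith)
  rw [pi_mul_div_two_eq hA n, Complex.sin_antiperiodic.sub_nat_mul_eq, norm_mul, norm_pow, norm_neg, norm_one,
    one_pow, one_mul]
  set u : ℂ := s + 2 * (n : ℂ) / (A : ℂ) with hu
  have hure : u.re = s.re + 2 * n / A := by
    rw [hu, show (2 * (n : ℂ) / (A : ℂ)) = ((2 * n / A : ℝ) : ℂ) by push_cast; rfl, Complex.add_re,
      Complex.ofReal_re]
  have hre : (((Real.pi * A / 2 : ℝ) : ℂ) * u).re = Real.pi * (n - x) := by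
    rw [Complex.re_ofReal_mul, hure, hx]
    field_simp
    ring
  have hbound : |(((Real.pi * A / 2 : ℝ) : ℂ) * u).re| ≤ Real.pi / 2 := by
    rw [hre, abs_mul, abs_of_pos hπ]
    have : |(n : ℝ) - x| ≤ 1 / 2 := abs_le.2 ⟨by linarith, by linarith⟩
    nlinarith
  refine lt_of_lt_of_le ?_ (mul_norm_le_norm_sin hbound)
  rw [norm_mul, Complex.norm_real, Real.norm_of_nonneg (by positivity)]
  have := h n hn0
  calc A * ε < A * ‖u‖ := by gcongr
    _ = _ := by field_simp

theorem existsUnique_sin_add_eq_zero {A ε : ℝ} (hA : 0 < A) (hε : 0 < ε) (hεA : A * ε ≤ 1 / 10)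
    {q : ℂ → ℂ} (n : ℕ)
    (hq : ∀ s : ℂ, ‖s + 2 * (n : ℂ) / (A : ℂ)‖ ≤ 2 * ε →
      DifferentiableAt ℂ q s ∧ ‖q s‖ ≤ A * ε / 6) :
    ∃! s : ℂ, ‖s + 2 * (n : ℂ) / (A : ℂ)‖ ≤ ε ∧
      Complex.sin (Real.pi * (A * s) / 2) + q s = 0 := by
  have hπ := Real.pi_pos
  have hA' : (A : ℂ) ≠ 0 := Complex.ofReal_ne_zero.2 hA.ne'
  have hπ' : (Real.pi : ℂ) ≠ 0 := Complex.ofReal_ne_zero.2 hπ.ne'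
  set z₀ : ℂ := -(2 * (n : ℂ) / (A : ℂ)) with hz₀
  -- The reciprocal of the derivative of `sin(π A s / 2)` at `-2n/A`, so that `f'` is close to `1`.
  set k : ℂ := ((2 / (Real.pi * A) : ℝ) : ℂ) * (-1) ^ n with hk
  have hk0 : k ≠ 0 := mul_ne_zero (Complex.ofReal_ne_zero.2 (by positivity)) (by simp)
  have hkn : ‖k‖ ≤ 1 / A := by
    rw [hk, norm_mul, norm_pow, norm_neg, norm_one, one_pow, mul_one, Complex.norm_real,
      Real.norm_of_nonneg (by positivity), div_le_div_iff₀ (by positivity) hA]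
    nlinarith [Real.two_le_pi]
  have hkq : ∀ (x : ℂ) (B : ℝ), ‖x‖ ≤ B * (A / 6) → ‖k * x‖ ≤ B / 6 := fun x B hx => by
    calc ‖k * x‖ = ‖k‖ * ‖x‖ := norm_mul _ _
      _ ≤ 1 / A * (B * (A / 6)) := by gcongr
      _ = B / 6 := by field_simp
  have hball : ∀ (s : ℂ) (δ : ℝ), s ∈ Metric.closedBall z₀ δ ↔
      ‖s + 2 * (n : ℂ) / (A : ℂ)‖ ≤ δ := fun s δ => by
    rw [mem_closedBall_iff_norm, hz₀, sub_neg_eq_add]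
  set f : ℂ → ℂ := fun s => k * (Complex.sin (Real.pi * (A * s) / 2) + q s) with hf
  have hmain := existsUnique_zero_of_norm_deriv_sub_one_le (f := f)
    (f' := fun s => k * (Complex.cos (Real.pi * (A * s) / 2) * (Real.pi * A / 2) + deriv q s))
    (z₀ := z₀) hε.le (fun s hs => ?_) (fun s hs => ?_) ?_
  · refine (existsUnique_congr fun s => ?_).1 hmain
    rw [hball, hf, mul_eq_zero, or_iff_right hk0]
  · have hqs := (hq s (((hball s ε).1 hs).trans (by linarith))).1.hasDerivAt
    have hlin : HasDerivAt (fun s : ℂ => (Real.pi : ℂ) * (A * s) / 2) (Real.pi * A / 2) s := by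
      have h := (hasDerivAt_id s).const_mul (Real.pi * A / 2 : ℂ)
      rw [mul_one] at h
      exact h.congr_of_eventuallyEq (Eventually.of_forall fun w => by simp only [id]; ring)
    exact (hlin.csin.add hqs).const_mul k
  · set u : ℂ := s + 2 * (n : ℂ) / (A : ℂ) with hu
    have hus : ‖u‖ ≤ ε := (hball s ε).1 hs
    -- Cauchy's estimate on a circle of radius `ε`, hence the hypothesis on the disc of radius `2
    -- ε`.
    have hderiv : ‖deriv q s‖ ≤ A / 6 := by
      have hsub : ∀ w ∈ Metric.closedBall s ε, ‖w + 2 * (n : ℂ) / (A : ℂ)‖ ≤ 2 * ε := fun w hw => by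
        have hw' := mem_closedBall_iff_norm.1 hw
        calc ‖w + 2 * (n : ℂ) / (A : ℂ)‖ = ‖(w - s) + u‖ := by rw [hu]; congr 1; ring
          _ ≤ ‖w - s‖ + ‖u‖ := norm_add_le _ _
          _ ≤ 2 * ε := by linarith
      have h := Complex.norm_deriv_le_of_forall_mem_sphere_norm_le (f := q) (c := s) hε
        (C := A * ε / 6)
        (DifferentiableOn.diffContOnCl_ball (U := Metric.closedBall s ε)
          (fun w hw => (hq w (hsub w hw)).1.differentiableWithinAt) subset_rfl)
        fun w hw => (hq w (hsub w (Metric.sphere_subset_closedBall hw))).2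
      refine h.trans (le_of_eq ?_)
      field_simp
    have hcos : k * (Complex.cos (Real.pi * (A * s) / 2) * (Real.pi * A / 2)) =
        Complex.cos ((Real.pi * A / 2 : ℝ) * u) := by
      have h1 : ((-1 : ℂ) ^ n) * (-1) ^ n = 1 := by rw [← mul_pow]; simp
      rw [pi_mul_div_two_eq hA n, ← hu, Complex.cos_antiperiodic.sub_nat_mul_eq, hk]
      push_cast
      field_simp
      linear_combination Complex.cos (Real.pi * A * u / 2) * h1
    have hv : ‖((Real.pi * A / 2 : ℝ) : ℂ) * u‖ ≤ 1 / 6 := by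
      rw [norm_mul, Complex.norm_real, Real.norm_of_nonneg (by positivity)]
      calc Real.pi * A / 2 * ‖u‖ ≤ Real.pi * A / 2 * ε := by gcongr
        _ = Real.pi / 2 * (A * ε) := by ring
        _ ≤ 3.15 / 2 * (1 / 10) := by gcongr; exact Real.pi_lt_d2.le
        _ ≤ 1 / 6 := by norm_num
    rw [mul_add, hcos, add_sub_right_comm]
    have h1 := norm_cos_sub_one_le (hv.trans (by norm_num))
    have h2 := hkq (deriv q s) 1 (by linarith)
    refine (norm_add_le _ _).trans ?_
    linarith
  · have hz : z₀ + 2 * (n : ℂ) / (A : ℂ) = 0 := by rw [hz₀]; ring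
    have hsin : Complex.sin (Real.pi * (A * z₀) / 2) = 0 := by
      rw [pi_mul_div_two_eq hA n, hz, mul_zero, zero_sub, Complex.sin_neg, Complex.sin_nat_mul_pi,
        neg_zero]
    simp only [hf, hsin, zero_add]
    have := hkq (q z₀) ε (by
      have := (hq z₀ (by rw [hz, norm_zero]; positivity)).2
      linarith)
    linarith

/-! ### The main theorem -/

theorem theorem2 (r : ℕ) (hr : 2 ≤ r) (a : Fin r → ℝ) (ha_pos : ∀ j, 0 < a j)
    (ha_anti : Antitone a) :
    ∃ ε₀ : ℝ, 0 < ε₀ ∧ ∀ (α : ℂ) (p ε : ℝ), 0 < p → 0 < ε → ε < ε₀ →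
      ∃ C₂ : ℝ, C₂ < 0 ∧
        (∀ s ∈ parabolicRegion C₂ p \ ⋃ n ∈ Set.Ici (1 : ℕ), trivialDisc a ε n,
          ¬ IsValuePoint (symmMultiZeta a) α s) ∧
        ∀ n : ℕ, 1 ≤ n → (trivialDisc a ε n ∩ parabolicRegion C₂ p).Nonempty →
          ∃! s : ℂ, s ∈ trivialDisc a ε n ∧ IsValuePoint (symmMultiZeta a) α s := by
  obtain ⟨c, hc, g, hg, hF⟩ := exists_symmMultiZeta_eq (by omega) a ha_pos
  have hA : 0 < ∑ j, a j :=
    Finset.sum_pos (fun i _ => ha_pos i) ⟨⟨0, by omega⟩, Finset.mem_univ _⟩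
  simp only [trivialDisc]
  set A := ∑ j, a j
  refine ⟨1 / (10 * A), by positivity, fun α p ε hp hε hε₀ => ?_⟩
  have hεA : A * ε ≤ 1 / 10 := by
    rw [lt_div_iff₀ (by positivity)] at hε₀
    linarith
  set D : ℂ → ℂ := fun s => dualZeta (1 - A * s) with hD
  set q : ℂ → ℂ := fun s => (g s - α) / (c * D s) with hq
  have hD0 : ∀ s : ℂ, s.re < 0 → D s ≠ 0 := fun s hs => by
    have hAs := mul_neg_of_pos_of_neg hA hs
    exact dualZeta_ne_zero (by simp; linarith)
  have hpoint : ∀ s : ℂ, s.re < 0 → (IsValuePoint (symmMultiZeta a) α s ↔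
      Complex.sin (Real.pi * (A * s) / 2) + q s = 0) := fun s hs => by
    have hAs : ((A : ℂ) * s).re < 0 := by simpa using mul_neg_of_pos_of_neg hA hs
    have key : symmMultiZeta a s - α =
        c * D s * (Complex.sin (Real.pi * (A * s) / 2) + q s) := by
      have h0 := hD0 s hs
      have hDs : D s = Complex.Gammaℂ (1 - A * s) * riemannZeta (1 - A * s) := rfl
      rw [(hF s hs).2, riemannZeta_eq_mul_sin hAs, hq, mul_add, mul_div_cancel₀ _
        (mul_ne_zero hc h0), hDs]
      ring
    rw [IsValuePoint, and_iff_right (hF s hs).1, ← sub_eq_zero, key, mul_eq_zero,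
      or_iff_right (mul_ne_zero hc (hD0 s hs))]
  have hqd : ∀ s : ℂ, s.re < 0 → DifferentiableAt ℂ q s := fun s hs => by
    have hU : ∀ᶠ w in 𝓝 s, w.re < 0 :=
      (isOpen_lt Complex.continuous_re continuous_const).mem_nhds hs
    have hgd : DifferentiableAt ℂ g s := by
      -- Differentiability of `g` is read off from `g = ζ̃ - c ζ(A s)` on the left half-plane.
      have h1 : DifferentiableAt ℂ (fun w => symmMultiZeta a w - c * riemannZeta (A * w)) s :=
        (hF s hs).1.differentiableAt.sub ((analyticAt_riemannZeta_mul (by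
          nlinarith)).differentiableAt.const_mul c)
      refine h1.congr_of_eventuallyEq ?_
      filter_upwards [hU] with w hw
      rw [(hF w hw).2]; ring
    have hre : 0 < (1 - (A : ℂ) * s).re := by
      have := mul_neg_of_pos_of_neg hA hs
      simp; linarith
    have hDd : DifferentiableAt ℂ D s := by
      have h1 : DifferentiableAt ℂ dualZeta (1 - A * s) := by
        refine DifferentiableAt.mul ?_ (differentiableAt_riemannZeta fun h => ?_)
        · have h2 := (Complex.differentiable_Gammaℂ_inv (1 - A * s)).inv (inv_ne_zero ?_)
          · exact h2.congr_of_eventuallyEq (Eventually.of_forall fun w => (inv_inv _).symm)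
          · intro h
            have := hD0 s hs
            simp [hD, dualZeta, h] at this
        · have := congrArg Complex.re h
          simp at this
          rcases this with h | h <;> linarith
      exact DifferentiableAt.comp s h1
        (by fun_prop : DifferentiableAt ℂ (fun s : ℂ => 1 - (A : ℂ) * s) s)
    exact (hgd.sub_const α).div (hDd.const_mul c) (mul_ne_zero hc (hD0 s hs))
  have hqsmall : ∀ᶠ s in leftParabola p, ‖q s‖ ≤ A * ε / 6 := by
    have h1 : (fun s => g s - α) =o[leftParabola p] D :=
      (isLittleO_of_mem_zetaProducts hp hg).sub (const_isLittleO_dualZeta hp hA α)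
    have h2 : (fun s => g s - α) =o[leftParabola p] fun s => c * D s :=
      h1.trans_isBigO (isBigO_self_const_mul hc _ _)
    have h3 := h2.tendsto_div_nhds_zero.norm
    rw [norm_zero] at h3
    exact h3.eventually_le_const (by positivity)
  obtain ⟨C, hC⟩ := eventually_leftParabola_iff.1 hqsmall
  set C₁ := min C (-(2 / A)) with hC₁
  have hC₁0 : C₁ < 0 := (min_le_right _ _).trans_lt (neg_neg_of_pos (by positivity))
  have hC₁A : ∀ s : ℂ, s.re ≤ C₁ → A * s.re ≤ -2 := fun s hs => by
    have h1 : s.re ≤ -(2 / A) := hs.trans (min_le_right _ _)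
    calc A * s.re ≤ A * -(2 / A) := by gcongr
      _ = -2 := by field_simp
  -- If the `ε`-disc meets the region at `s₀`, a point `s` of the `2 ε`-disc has `s.re ≤ s₀.re + 3
  -- ε` and `p * s.im ^ 2 ≤ 4 p ε ^ 2`; this margin keeps the whole `2 ε`-disc in the region where
  -- `q` is small.
  refine ⟨C₁ - 3 * ε - 4 * p * ε ^ 2, by nlinarith [mul_pos hp (pow_pos hε 2)],
    fun s ⟨hs, hsn⟩ => ?_, fun n hn hmeet => ?_⟩
  · simp only [Set.mem_iUnion, Set.mem_Ici, Set.mem_ofPred_eq, not_exists, not_le] at hsn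
    have hsre : s.re ≤ C₁ - 3 * ε - 4 * p * ε ^ 2 := le_trans hs (min_le_left _ _)
    have hs1 : s.re ≤ C₁ := by nlinarith [mul_pos hp (pow_pos hε 2)]
    have hqs := hC s (le_min (hs1.trans (min_le_left _ _)) (le_trans hs (min_le_right _ _)))
    have hsin := le_norm_sin_of_forall_lt hA (hC₁A s hs1) hsn
    rw [hpoint s (by linarith)]
    intro h
    -- A solution would give `A ε < |sin| = |q| ≤ A ε / 6`.
    rw [eq_neg_of_add_eq_zero_left h, norm_neg] at hsin
    nlinarith [mul_pos hA hε]
  · obtain ⟨s₀, hs₀, hs₀'⟩ := hmeet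
    have hs₀re : s₀.re ≤ C₁ - 3 * ε - 4 * p * ε ^ 2 := le_trans hs₀' (min_le_left _ _)
    have hdisc : ∀ s : ℂ, ‖s + 2 * (n : ℂ) / (A : ℂ)‖ ≤ 2 * ε →
        s.re < 0 ∧ s ∈ parabolicRegion C p := fun s hs => by
      have e : 2 * (n : ℂ) / (A : ℂ) = ((2 * n / A : ℝ) : ℂ) := by push_cast; rfl
      have h1 : |s.re + 2 * n / A| ≤ 2 * ε := by
        have := (Complex.abs_re_le_norm _).trans hs
        rwa [e, Complex.add_re, Complex.ofReal_re] at this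
      have h2 : |s₀.re + 2 * n / A| ≤ ε := by
        have := (Complex.abs_re_le_norm _).trans hs₀
        rwa [e, Complex.add_re, Complex.ofReal_re] at this
      have h3 : |s.im| ≤ 2 * ε := by
        have := (Complex.abs_im_le_norm _).trans hs
        rwa [e, Complex.add_im, Complex.ofReal_im, add_zero] at this
      have h4 : s.im ^ 2 ≤ (2 * ε) ^ 2 := sq_le_sq' (abs_le.1 h3).1 (abs_le.1 h3).2
      have h5 := mul_le_mul_of_nonneg_left h4 hp.le
      have h6 : s.re ≤ C₁ - 4 * p * ε ^ 2 := by
        linarith [(abs_le.1 h1).2, (abs_le.1 h2).1]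
      have h7 : 0 < p * ε ^ 2 := by positivity
      refine ⟨by linarith, show s.re ≤ min C (-p * s.im ^ 2) from le_min ?_ ?_⟩
      · linarith [(min_le_left _ _ : C₁ ≤ C)]
      · linarith
    refine (existsUnique_congr fun s => and_congr_right fun hs => ?_).2
      (existsUnique_sin_add_eq_zero hA hε hεA n fun s hs =>
        ⟨hqd s (hdisc s hs).1, hC s (hdisc s hs).2⟩)
    exact hpoint s (hdisc s (le_trans hs (by linarith))).1
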